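/- Let $\mathbb{C}\langle X,Y\rangle$ be the free associative unital $\mathbb{C}$-algebra on two noncommuting variables $X,Y$, and $\mathbb{R}\langle X,Y\rangle\subseteq\mathbb{C}\langle X,Y\rangle$ the free associative unital $\mathbb{R}$-algebra on them. Two elements $p,q\in\mathbb{C}\langle X,Y\rangle$ are called cyclically equivalent if $p-q$ is a finite sum of commutators $ab-ba$ with $a,b\in\mathbb{C}\langle X,Y\rangle$. A word $w$ in $X,Y$ is called cyclically sorted if it is cyclically equivalent to $X^iY^j$ for some integers $i,j\ge 0$, and a polynomial $f\in\mathbb{C}\langle X,Y\rangle$ is called cyclically sorted if it is a $\mathbb{C}$-linear combination of cyclically sorted words. Let $\pi:\mathbb{C}\langle X,Y\rangle\to\mathbb{C}[X,Y]$ be the canonical ring epimorphism that lets the variables commute. Let $*$ be the involution on $\mathbb{R}\langle X,Y\rangle$ that fixes the elements of $\mathbb{R}\cup\{X,Y\}$ (and hence reverses words), and let $M_{\mathbb{R}}$ be the quadratic module generated by $1-X^2$ and $1-Y^2$ in $\mathbb{R}\langle X,Y\rangle$, i.e., the smallest set $M$ of elements $m\in\mathbb{R}\langle X,Y\rangle$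 with $m^*=m$ such that $1,\,1-X^2,\,1-Y^2\in M$, $M+M\subseteq M$, and $g^*Mg\subseteq M$ for all $g\in\mathbb{R}\langle X,Y\rangle$. **Proposition.** Let $f\in\mathbb{C}\langle X,Y\rangle$ be cyclically sorted. Suppose that $\pi(f)\ge 0$ on $[-1,1]^2$, i.e., for all $(x,y)\in[-1,1]^2$ the value $\pi(f)(x,y)$ is real and nonnegative. Then for every real $\varepsilon>0$, $f+\varepsilon$ is cyclically equivalent to an element of $M_{\mathbb{R}}$. -/

import Mathlib

namespace CycSorted

/-- Two elements of a ring are cyclically equivalent if their difference is a (finite) sum of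
commutators `a * b - b * a`. -/
def CycEquiv {A : Type*} [Ring A] (f g : A) : Prop :=
  f - g ∈ AddSubmonoid.closure {c : A | ∃ a b : A, c = a * b - b * a}

/-- A quadratic module in a ring with involution: a set of symmetric elements that contains `1`
and is closed under sums and under `m ↦ g* m g` for every ring element `g`. -/
structure IsQuadraticModule {A : Type*} [Ring A] [StarRing A] (M : Set A) : Prop where
  symm : ∀ m ∈ M, star m = m
  one_mem : (1 : A) ∈ M
  add_mem : ∀ m₁ ∈ M, ∀ m₂ ∈ M, m₁ + m₂ ∈ M
  conj_mem : ∀ g : A, ∀ m ∈ M, star g * m * g ∈ M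

/-- The quadratic module generated by a set `S` of symmetric elements: the intersection of all
quadratic modules containing `S`. -/
def quadraticModuleSpan {A : Type*} [Ring A] [StarRing A] (S : Set A) : Set A :=
  ⋂₀ {M : Set A | IsQuadraticModule M ∧ S ⊆ M}

/-- The intersection above is itself a quadratic module, for symmetric generators. -/
theorem isQuadraticModule_quadraticModuleSpan {A : Type*} [Ring A] [StarRing A] {S : Set A}
    (hS : ∀ s ∈ S, star s = s) : IsQuadraticModule (quadraticModuleSpan S) where
  symm := by
    intro m hm
    refine hm {a : A | star a = a} ⟨⟨fun _ h => h, star_one A, ?_, ?_⟩, hS⟩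
    · intro a ha b hb
      simp only [Set.mem_ofPred_eq] at *
      rw [star_add, ha, hb]
    · intro g a ha
      simp only [Set.mem_ofPred_eq] at *
      rw [star_mul, star_mul, star_star, ha, mul_assoc]
  one_mem := fun _ hM => hM.1.one_mem
  add_mem := fun _ h₁ _ h₂ M hM => hM.1.add_mem _ (h₁ M hM) _ (h₂ M hM)
  conj_mem := fun g _ h M hM => hM.1.conj_mem g _ (h M hM)

/-- `M_ℝ`: the quadratic module generated by the elements `1 - X_i ^ 2` in the free real algebra
on `X_1, …, X_n`. The involution is the one of Mathlib on `FreeAlgebra`: it fixes the real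
coefficients and the letters `X_i`, and reverses words. -/
def realQuadraticModule (n : ℕ) : Set (FreeAlgebra ℝ (Fin n)) :=
  quadraticModuleSpan (Set.range fun i : Fin n => 1 - FreeAlgebra.ι ℝ i ^ 2)

/-- The inclusion of the free real algebra into the free complex algebra. -/
noncomputable def realToComplex (n : ℕ) : FreeAlgebra ℝ (Fin n) →ₐ[ℝ] FreeAlgebra ℂ (Fin n) :=
  FreeAlgebra.lift ℝ (FreeAlgebra.ι ℂ)

/-- A word in the letters `X_1, …, X_n`, as an element of the free complex algebra. -/
noncomputable def word {n : ℕ} (w : FreeMonoid (Fin n)) : FreeAlgebra ℂ (Fin n) :=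
  FreeMonoid.lift (FreeAlgebra.ι ℂ) w

/-- A word in two letters `X` (index `0`) and `Y` (index `1`) is cyclically sorted if it is
cyclically equivalent to `X ^ i * Y ^ j` for some `i` and `j`. -/
def IsCycSortedWord (w : FreeMonoid (Fin 2)) : Prop :=
  ∃ i j : ℕ, CycEquiv (word w) (FreeAlgebra.ι ℂ 0 ^ i * FreeAlgebra.ι ℂ 1 ^ j)

/-- A noncommutative polynomial is cyclically sorted if it is a complex linear combination of
cyclically sorted words. -/
def IsCycSorted (f : FreeAlgebra ℂ (Fin 2)) : Prop :=
  f ∈ Submodule.span ℂ {p | ∃ w : FreeMonoid (Fin 2), IsCycSortedWord w ∧ p = word w}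

/-- The canonical epimorphism onto commutative polynomials, letting the variables commute. -/
noncomputable def commImage : FreeAlgebra ℂ (Fin 2) →ₐ[ℂ] MvPolynomial (Fin 2) ℂ :=
  FreeAlgebra.lift ℂ MvPolynomial.X

/-- A complex commutative polynomial in two variables is nonnegative on `[-1,1]²`: at each point
of the (real) square its value is a real number and is at least `0`. -/
def NonnegOnSquare (p : MvPolynomial (Fin 2) ℂ) : Prop :=
  ∀ x : Fin 2 → ℝ, (∀ i, x i ∈ Set.Icc (-1 : ℝ) 1) →
    ∃ r : ℝ, 0 ≤ r ∧ MvPolynomial.eval (fun i => (x i : ℂ)) p = (r : ℂ)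

end CycSorted

/-!
The cone `cycCone 2` of elements of `ℝ⟨X, Y⟩` cyclically equivalent to an element of `M_ℝ` is closed
under sums and nonnegative scalings, and three facts about it give the result.

* A univariate polynomial positive on `[-1, 1]` lies in the univariate quadratic module generated by
  `1 - X ^ 2` (`mem_intervalCone_of_pos`, by factoring into irreducibles), hence can be evaluated
  at a letter to give an element of `M_ℝ`.
* `q(X)² h(Y)` is cyclically equivalent to `q(X) h(Y) q(X)`, which is in `M_ℝ` when `h` is in the
  univariate quadratic module (`aeval_sq_mul_aeval_mem_cycCone`).
* If `|r| < δ` and `|h| < K` on `[-1, 1]`, then `δ K + r(X) h(Y)` is in the cone, since `2 R H` is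
  cyclically equivalent to `(R + H)² - R² - H²` (`algebraMap_add_aeval_mul_aeval_mem_cycCone`).

The last fact makes uniform approximation in one variable at a time harmless at the cost of `ε`.
Approximating `√p` by polynomials, `p(X) h(Y) + ε` is in the cone whenever `p ≥ 0` on `[-1, 1]` and
`h` is in the univariate quadratic module. A sorted polynomial `Q(X, Y)` is close, through Bernstein
approximation in `Y`, to `∑ k, Q(X, t k) b k (Y)`, a sum of such products
(`algebraMap_add_sortedLift_mem_cycCone`). Finally, a cyclically sorted `f` is cyclically equivalent
to the sorted form of its commutative collapse, whose coefficients are real because it takes real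
values on the square.
-/

open Polynomial

namespace CycSorted

/-! ### Cyclic equivalence -/

namespace CycEquiv

variable {A : Type*} [Ring A]

theorem mul_comm (a b : A) : CycEquiv (a * b) (b * a) :=
  AddSubmonoid.subset_closure ⟨a, b, rfl⟩

theorem refl (a : A) : CycEquiv a a := by
  unfold CycEquiv
  simp

theorem of_eq {a b : A} (h : a = b) : CycEquiv a b := h ▸ refl a

theorem trans {a b c : A} (h₁ : CycEquiv a b) (h₂ : CycEquiv b c) : CycEquiv a c := by
  unfold CycEquiv at *
  simpa using add_mem h₁ h₂

theorem add {a b c d : A} (h₁ : CycEquiv a b) (h₂ : CycEquiv c d) :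
    CycEquiv (a + c) (b + d) := by
  unfold CycEquiv at *
  rw [add_sub_add_comm]
  exact add_mem h₁ h₂

theorem smul {R : Type*} [CommSemiring R] [Algebra R A] (r : R) {a b : A} (h : CycEquiv a b) :
    CycEquiv (r • a) (r • b) := by
  unfold CycEquiv at *
  rw [← smul_sub]
  generalize a - b = c at h
  induction h using AddSubmonoid.closure_induction with
  | mem x hx =>
    obtain ⟨a, b, rfl⟩ := hx
    exact AddSubmonoid.subset_closure ⟨r • a, b, by simp [smul_sub]⟩
  | zero => simp
  | add x y _ _ hx hy => rw [smul_add]; exact add_mem hx hy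

theorem map {B : Type*} [Ring B] (φ : A →+* B) {a b : A} (h : CycEquiv a b) :
    CycEquiv (φ a) (φ b) := by
  unfold CycEquiv at *
  rw [← map_sub]
  generalize a - b = c at h
  induction h using AddSubmonoid.closure_induction with
  | mem x hx =>
    obtain ⟨a, b, rfl⟩ := hx
    exact AddSubmonoid.subset_closure ⟨φ a, φ b, by simp⟩
  | zero => simp
  | add x y _ _ hx hy => rw [map_add]; exact add_mem hx hy

/-- In a commutative ring all commutators vanish. -/
theorem eq {B : Type*} [CommRing B] {a b : B} (h : CycEquiv a b) : a = b := by
  unfold CycEquiv at h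
  rw [← sub_eq_zero]
  generalize a - b = c at h
  induction h using AddSubmonoid.closure_induction with
  | mem x hx =>
    obtain ⟨a, b, rfl⟩ := hx
    rw [_root_.mul_comm, sub_self]
  | zero => rfl
  | add x y _ _ hx hy => rw [hx, hy, add_zero]

end CycEquiv

/-! ### Univariate polynomials positive on the interval -/

/-- The univariate quadratic module generated by `1 - X ^ 2`: polynomials `a + b * (1 - X ^ 2)`
with `a`, `b` sums of squares. In one (commuting) variable and with a single generator it is closed
under multiplication, so it is recorded as a subsemiring. -/
def intervalCone : Subsemiring ℝ[X] where
  carrier := {p | ∃ a b : ℝ[X], IsSumSq a ∧ IsSumSq b ∧ p = a + b * (1 - X ^ 2)}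
  mul_mem' := by
    rintro _ _ ⟨a, b, ha, hb, rfl⟩ ⟨c, d, hc, hd, rfl⟩
    refine ⟨a * c + b * d * ((1 - X ^ 2) * (1 - X ^ 2)), a * d + b * c,
      (ha.mul hc).add ((hb.mul hd).mul (.mul_self _)), (ha.mul hd).add (hb.mul hc), by ring⟩
  one_mem' := ⟨1, 0, .one, .zero, by simp⟩
  add_mem' := by
    rintro _ _ ⟨a, b, ha, hb, rfl⟩ ⟨c, d, hc, hd, rfl⟩
    exact ⟨a + c, b + d, ha.add hc, hb.add hd, by ring⟩
  zero_mem' := ⟨0, 0, .zero, .zero, by simp⟩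

theorem sq_mem_intervalCone (p : ℝ[X]) : p ^ 2 ∈ intervalCone :=
  ⟨p ^ 2, 0, by rw [sq]; exact .mul_self p, .zero, by simp⟩

theorem C_mem_intervalCone {c : ℝ} (hc : 0 ≤ c) : C c ∈ intervalCone := by
  have := sq_mem_intervalCone (C √c)
  rwa [← C_pow, Real.sq_sqrt hc] at this

theorem one_sub_sq_mem_intervalCone : (1 - X ^ 2 : ℝ[X]) ∈ intervalCone :=
  ⟨0, 1, .zero, .one, by simp⟩

theorem C_half_add_half : (C (1 / 2) + C (1 / 2) : ℝ[X]) = 1 := by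
  rw [← C_add]
  norm_num

theorem one_add_X_mem_intervalCone : (1 + X : ℝ[X]) ∈ intervalCone := by
  have h : (1 + X : ℝ[X]) = C (1 / 2) * ((1 + X) ^ 2 + (1 - X ^ 2)) := by
    linear_combination (-(1 + X)) * C_half_add_half
  rw [h]
  exact mul_mem (C_mem_intervalCone (by norm_num))
    (add_mem (sq_mem_intervalCone _) one_sub_sq_mem_intervalCone)

theorem one_sub_X_mem_intervalCone : (1 - X : ℝ[X]) ∈ intervalCone := by
  have h : (1 - X : ℝ[X]) = C (1 / 2) * ((1 - X) ^ 2 + (1 - X ^ 2)) := by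
    linear_combination (-(1 - X)) * C_half_add_half
  rw [h]
  exact mul_mem (C_mem_intervalCone (by norm_num))
    (add_mem (sq_mem_intervalCone _) one_sub_sq_mem_intervalCone)

theorem eval_nonneg_of_mem_intervalCone {p : ℝ[X]} (hp : p ∈ intervalCone) {x : ℝ}
    (hx : x ∈ Set.Icc (-1 : ℝ) 1) : 0 ≤ p.eval x := by
  obtain ⟨a, b, ha, hb, rfl⟩ := hp
  have key : ∀ s : ℝ[X], IsSumSq s → 0 ≤ s.eval x := by
    intro s hs
    induction hs with
    | zero => simp
    | sq_add q _ ih =>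
      rw [eval_add, eval_mul]
      exact add_nonneg (mul_self_nonneg _) ih
  have h1 : 0 ≤ 1 - x ^ 2 := by nlinarith [hx.1, hx.2]
  simpa using add_nonneg (key a ha) (mul_nonneg (key b hb) h1)

/-- Over the reals an irreducible polynomial has degree at most two: a linear one is `± (c ± X)`
with `c > 1` up to a positive factor, and a quadratic one is, up to sign, a square plus a positive
constant. -/
theorem mem_intervalCone_or_neg_mem_of_irreducible {p : ℝ[X]} (hp : Irreducible p)
    (hroot : ∀ x ∈ Set.Icc (-1 : ℝ) 1, p.eval x ≠ 0) :
    p ∈ intervalCone ∨ -p ∈ intervalCone := by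
  obtain ⟨a, b, c, rfl⟩ : ∃ a b c : ℝ, p = C a * X ^ 2 + C b * X + C c :=
    ⟨_, _, _, eq_quadratic_of_degree_le_two hp.degree_le_two⟩
  by_cases ha : a = 0
  · subst ha
    have hev : ∀ x ∈ Set.Icc (-1 : ℝ) 1, b * x + c ≠ 0 := by simpa using hroot
    have hlin : ∀ b c : ℝ, |b| ≤ c → (C b * X + C c : ℝ[X]) ∈ intervalCone := by
      intro b c h
      rcases le_total 0 b with hb | hb
      · rw [abs_of_nonneg hb] at h
        have : (C b * X + C c : ℝ[X]) = C b * (1 + X) + C (c - b) := by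
          rw [C_sub]; ring
        rw [this]
        exact add_mem (mul_mem (C_mem_intervalCone hb) one_add_X_mem_intervalCone)
          (C_mem_intervalCone (by linarith))
      · rw [abs_of_nonpos hb] at h
        have : (C b * X + C c : ℝ[X]) = C (-b) * (1 - X) + C (c + b) := by
          rw [C_add, C_neg]; ring
        rw [this]
        exact add_mem (mul_mem (C_mem_intervalCone (by linarith)) one_sub_X_mem_intervalCone)
          (C_mem_intervalCone (by linarith))
    -- otherwise the root `-c / b` lies in `[-1, 1]`
    have hbc : |b| ≤ |c| := by
      by_contra! hlt
      have hb : b ≠ 0 := by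
        rintro rfl
        simp at hlt
        exact absurd hlt (not_lt.mpr (abs_nonneg c))
      have h1 : |-c / b| ≤ 1 := by
        rw [abs_div, abs_neg, div_le_one (abs_pos.mpr hb)]
        exact hlt.le
      exact hev (-c / b) (abs_le.mp h1) (by field_simp; ring)
    rcases le_total 0 c with hc | hc
    · left
      simpa using hlin b c (by rwa [abs_of_nonneg hc] at hbc)
    · right
      have := hlin (-b) (-c) (by rwa [abs_neg, ← abs_of_nonpos hc])
      convert this using 1
      simp only [C_0, C_neg]
      ring
  · -- a quadratic polynomial with a real root is reducible
    have hdisc : b ^ 2 - 4 * a * c < 0 := by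
      by_contra! hd
      obtain ⟨x, hx⟩ := exists_quadratic_eq_zero ha ⟨√(discrim a b c), by
        rw [Real.mul_self_sqrt]; exact hd⟩
      have h2 : (C a * X ^ 2 + C b * X + C c : ℝ[X]).degree = 1 :=
        degree_eq_one_of_irreducible_of_root hp (x := x) (by simp [IsRoot]; linarith)
      rw [degree_quadratic ha] at h2
      norm_num at h2
    have hquad : ∀ a b c : ℝ, 0 < a → b ^ 2 - 4 * a * c < 0 →
        (C a * X ^ 2 + C b * X + C c : ℝ[X]) ∈ intervalCone := by
      intro a b c ha hd
      have : (C a * X ^ 2 + C b * X + C c : ℝ[X]) =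
          C a * (X + C (b / (2 * a))) ^ 2 + C ((4 * a * c - b ^ 2) / (4 * a)) := by
        refine Polynomial.funext fun x => ?_
        simp
        field_simp
        ring
      rw [this]
      exact add_mem (mul_mem (C_mem_intervalCone ha.le) (sq_mem_intervalCone _))
        (C_mem_intervalCone (div_nonneg (by linarith) (by linarith)))
    rcases lt_or_gt_of_ne ha with h | h
    · right
      have := hquad (-a) (-b) (-c) (by linarith) (by linarith)
      convert this using 1
      simp only [C_neg]
      ring
    · exact .inl (hquad a b c h hdisc)

theorem mem_intervalCone_or_neg_mem (p : ℝ[X])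
    (hroot : ∀ x ∈ Set.Icc (-1 : ℝ) 1, p.eval x ≠ 0) :
    p ∈ intervalCone ∨ -p ∈ intervalCone := by
  induction p using WfDvdMonoid.induction_on_irreducible with
  | zero => exact .inl (zero_mem _)
  | unit u hu =>
    obtain ⟨c, -, rfl⟩ := Polynomial.isUnit_iff.mp hu
    rcases le_total 0 c with hc | hc
    · exact .inl (C_mem_intervalCone hc)
    · exact .inr (by rw [← C_neg]; exact C_mem_intervalCone (by linarith))
  | mul a i _ hi ih =>
    simp only [eval_mul, mul_ne_zero_iff] at hroot
    rcases mem_intervalCone_or_neg_mem_of_irreducible hi fun x hx => (hroot x hx).1 with h | h <;>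
    rcases ih fun x hx => (hroot x hx).2 with h' | h'
    · exact .inl (mul_mem h h')
    · exact .inr (by simpa using mul_mem h h')
    · exact .inr (by simpa using mul_mem h h')
    · exact .inl (by simpa using mul_mem h h')

theorem mem_intervalCone_of_pos {p : ℝ[X]} (hp : ∀ x ∈ Set.Icc (-1 : ℝ) 1, 0 < p.eval x) :
    p ∈ intervalCone := by
  refine (mem_intervalCone_or_neg_mem p fun x hx => (hp x hx).ne').resolve_right fun h => ?_
  have h0 : (0 : ℝ) ∈ Set.Icc (-1 : ℝ) 1 := by norm_num
  have h1 := eval_nonneg_of_mem_intervalCone h h0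
  have h2 := hp 0 h0
  rw [eval_neg] at h1
  linarith

/-! ### The cone of elements cyclically equivalent to the quadratic module -/

theorem isQuadraticModule_realQuadraticModule (n : ℕ) :
    IsQuadraticModule (realQuadraticModule n) := by
  refine isQuadraticModule_quadraticModuleSpan ?_
  rintro _ ⟨i, rfl⟩
  simp

theorem one_sub_sq_mem_realQuadraticModule {n : ℕ} (i : Fin n) :
    1 - FreeAlgebra.ι ℝ i ^ 2 ∈ realQuadraticModule n :=
  fun _ hM => hM.2 ⟨i, rfl⟩

theorem zero_mem_realQuadraticModule (n : ℕ) : 0 ∈ realQuadraticModule n := by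
  have h := isQuadraticModule_realQuadraticModule n
  simpa using h.conj_mem 0 1 h.one_mem

theorem star_aeval_ι {n : ℕ} (i : Fin n) (p : ℝ[X]) :
    star (aeval (FreeAlgebra.ι ℝ i) p) = aeval (FreeAlgebra.ι ℝ i) p := by
  induction p using Polynomial.induction_on' with
  | add p q hp hq => rw [map_add, star_add, hp, hq]
  | monomial k c =>
    rw [aeval_monomial, star_mul, star_pow, FreeAlgebra.star_ι, FreeAlgebra.star_algebraMap,
      Algebra.commutes]

theorem aeval_mem_realQuadraticModule {n : ℕ} (i : Fin n) {p : ℝ[X]} (hp : p ∈ intervalCone) :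
    aeval (FreeAlgebra.ι ℝ i) p ∈ realQuadraticModule n := by
  have hM := isQuadraticModule_realQuadraticModule n
  have key : ∀ s t : ℝ[X], IsSumSq s → aeval (FreeAlgebra.ι ℝ i) t ∈ realQuadraticModule n →
      aeval (FreeAlgebra.ι ℝ i) (s * t) ∈ realQuadraticModule n := by
    intro s t hs ht
    induction hs with
    | zero => simpa using zero_mem_realQuadraticModule n
    | @sq_add q s' _ ih =>
      rw [show (q * q + s') * t = q * t * q + s' * t by ring, map_add, map_mul, map_mul]
      refine hM.add_mem _ ?_ _ ih
      have := hM.conj_mem (aeval (FreeAlgebra.ι ℝ i) q) _ ht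
      rwa [star_aeval_ι] at this
  obtain ⟨a, b, ha, hb, rfl⟩ := hp
  rw [map_add]
  refine hM.add_mem _ ?_ _ (key b _ hb ?_)
  · simpa using key a 1 ha (by simpa using hM.one_mem)
  · simpa using one_sub_sq_mem_realQuadraticModule i

/-- The elements of the free real algebra that are cyclically equivalent to an element of
`M_ℝ`. -/
def cycCone (n : ℕ) : AddSubmonoid (FreeAlgebra ℝ (Fin n)) where
  carrier := {a | ∃ g ∈ realQuadraticModule n, CycEquiv a g}
  add_mem' := by
    rintro a b ⟨g, hg, hag⟩ ⟨k, hk, hbk⟩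
    exact ⟨g + k, (isQuadraticModule_realQuadraticModule n).add_mem _ hg _ hk, hag.add hbk⟩
  zero_mem' := ⟨0, zero_mem_realQuadraticModule n, .refl 0⟩

theorem mem_cycCone_of_cycEquiv {n : ℕ} {a b : FreeAlgebra ℝ (Fin n)} (h : CycEquiv a b)
    (hb : b ∈ cycCone n) : a ∈ cycCone n := by
  obtain ⟨g, hg, hbg⟩ := hb
  exact ⟨g, hg, h.trans hbg⟩

theorem mem_cycCone_of_mem {n : ℕ} {a : FreeAlgebra ℝ (Fin n)}
    (h : a ∈ realQuadraticModule n) : a ∈ cycCone n :=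
  ⟨a, h, .refl a⟩

theorem smul_mem_cycCone {n : ℕ} {c : ℝ} (hc : 0 ≤ c) {a : FreeAlgebra ℝ (Fin n)}
    (h : a ∈ cycCone n) : c • a ∈ cycCone n := by
  obtain ⟨g, hg, hag⟩ := h
  refine ⟨c • g, ?_, hag.smul c⟩
  have := (isQuadraticModule_realQuadraticModule n).conj_mem
    (algebraMap ℝ (FreeAlgebra ℝ (Fin n)) √c) g hg
  rwa [FreeAlgebra.star_algebraMap, mul_assoc, ← Algebra.commutes, ← mul_assoc, ← map_mul,
    Real.mul_self_sqrt hc, ← Algebra.smul_def] at this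

theorem algebraMap_mem_cycCone {n : ℕ} {c : ℝ} (hc : 0 ≤ c) :
    algebraMap ℝ (FreeAlgebra ℝ (Fin n)) c ∈ cycCone n := by
  rw [Algebra.algebraMap_eq_smul_one]
  exact smul_mem_cycCone hc
    (mem_cycCone_of_mem (isQuadraticModule_realQuadraticModule n).one_mem)

/-! ### Products of a polynomial in `X` and a polynomial in `Y` -/

theorem aeval_sq_mul_aeval_mem_cycCone {n : ℕ} (i j : Fin n) (q : ℝ[X]) {h : ℝ[X]}
    (hh : h ∈ intervalCone) :
    aeval (FreeAlgebra.ι ℝ i) (q ^ 2) * aeval (FreeAlgebra.ι ℝ j) h ∈ cycCone n := by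
  have hM := (isQuadraticModule_realQuadraticModule n).conj_mem
    (aeval (FreeAlgebra.ι ℝ i) q) _ (aeval_mem_realQuadraticModule j hh)
  rw [star_aeval_ι] at hM
  refine ⟨_, hM, ?_⟩
  rw [sq, map_mul, mul_assoc, mul_assoc]
  refine (CycEquiv.mul_comm _ _).trans (.of_eq ?_)
  rw [mul_assoc]

/-- The noncommutative Cauchy–Schwarz step: up to cyclic equivalence
`2 (1 + R H) = (R + H)² + (1 - R²) + (1 - H²)` for `R = r(X_i)` and `H = h(X_j)`. -/
theorem one_add_aeval_mul_aeval_mem_cycCone {n : ℕ} (i j : Fin n) {r h : ℝ[X]}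
    (hr : ∀ x ∈ Set.Icc (-1 : ℝ) 1, |r.eval x| < 1)
    (hh : ∀ x ∈ Set.Icc (-1 : ℝ) 1, |h.eval x| < 1) :
    1 + aeval (FreeAlgebra.ι ℝ i) r * aeval (FreeAlgebra.ι ℝ j) h ∈ cycCone n := by
  have hM := isQuadraticModule_realQuadraticModule n
  have hsq : ∀ (k : Fin n) (p : ℝ[X]), (∀ x ∈ Set.Icc (-1 : ℝ) 1, |p.eval x| < 1) →
      1 - aeval (FreeAlgebra.ι ℝ k) p ^ 2 ∈ realQuadraticModule n := by
    intro k p hp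
    have : (1 - p ^ 2) ∈ intervalCone := by
      refine mem_intervalCone_of_pos fun x hx => ?_
      have := (sq_lt_one_iff_abs_lt_one (p.eval x)).mpr (hp x hx)
      simpa using this
    simpa using aeval_mem_realQuadraticModule k this
  have h1 := hM.conj_mem (aeval (FreeAlgebra.ι ℝ i) r + aeval (FreeAlgebra.ι ℝ j) h) 1 hM.one_mem
  rw [star_add, star_aeval_ι, star_aeval_ι, mul_one] at h1
  have h2 := smul_mem_cycCone (c := 1 / 2) (by norm_num) (mem_cycCone_of_mem
    (hM.add_mem _ (hM.add_mem _ h1 _ (hsq i r hr)) _ (hsq j h hh)))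
  refine mem_cycCone_of_cycEquiv ?_ h2
  generalize aeval (FreeAlgebra.ι ℝ i) r = R
  generalize aeval (FreeAlgebra.ι ℝ j) h = H
  have e1 : 1 + R * H = (1 / 2 : ℝ) • (R * H) + (1 + (1 / 2 : ℝ) • (R * H)) := by module
  have e2 : (1 / 2 : ℝ) • ((R + H) * (R + H) + (1 - R ^ 2) + (1 - H ^ 2)) =
      (1 / 2 : ℝ) • (H * R) + (1 + (1 / 2 : ℝ) • (R * H)) := by
    rw [add_mul, mul_add, mul_add, sq, sq]
    module
  rw [e1, e2]
  exact ((CycEquiv.mul_comm R H).smul _).add (.refl _)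

theorem algebraMap_add_aeval_mul_aeval_mem_cycCone {n : ℕ} (i j : Fin n) {r h : ℝ[X]} {δ K : ℝ}
    (hδ : 0 < δ) (hK : 0 < K)
    (hr : ∀ x ∈ Set.Icc (-1 : ℝ) 1, |r.eval x| < δ)
    (hh : ∀ x ∈ Set.Icc (-1 : ℝ) 1, |h.eval x| < K) :
    algebraMap ℝ _ (δ * K) + aeval (FreeAlgebra.ι ℝ i) r * aeval (FreeAlgebra.ι ℝ j) h ∈
      cycCone n := by
  have hscale : ∀ (p : ℝ[X]) (c : ℝ), 0 < c → (∀ x ∈ Set.Icc (-1 : ℝ) 1, |p.eval x| < c) →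
      ∀ x ∈ Set.Icc (-1 : ℝ) 1, |(c⁻¹ • p).eval x| < 1 := by
    intro p c hc hp x hx
    rw [eval_smul, smul_eq_mul, abs_mul, abs_of_pos (inv_pos.mpr hc), inv_mul_lt_one₀ hc]
    exact hp x hx
  have h1 := smul_mem_cycCone (mul_pos hδ hK).le
    (one_add_aeval_mul_aeval_mem_cycCone i j (hscale r δ hδ hr) (hscale h K hK hh))
  convert h1 using 1
  rw [smul_add, ← Algebra.algebraMap_eq_smul_one, map_smul, map_smul, smul_mul_smul_comm,
    smul_smul, ← mul_inv, mul_inv_cancel₀ (mul_pos hδ hK).ne', one_smul]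

theorem exists_abs_eval_lt (p : ℝ[X]) :
    ∃ K : ℝ, 0 < K ∧ ∀ x ∈ Set.Icc (-1 : ℝ) 1, |p.eval x| < K := by
  obtain ⟨K, hK⟩ := isCompact_Icc.exists_bound_of_continuousOn
    (p.continuous.continuousOn (s := Set.Icc (-1 : ℝ) 1))
  refine ⟨|K| + 1, by positivity, fun x hx => ?_⟩
  have := hK x hx
  rw [Real.norm_eq_abs] at this
  linarith [le_abs_self K]

theorem exists_sq_near {p : ℝ[X]} (hp : ∀ x ∈ Set.Icc (-1 : ℝ) 1, 0 ≤ p.eval x) {δ : ℝ}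
    (hδ : 0 < δ) :
    ∃ q : ℝ[X], ∀ x ∈ Set.Icc (-1 : ℝ) 1, |(p - q ^ 2).eval x| < δ := by
  obtain ⟨K, hK, hpK⟩ := exists_abs_eval_lt p
  set η := min 1 (δ / (2 * √K + 1)) with hη
  have hη0 : 0 < η := lt_min one_pos (by positivity)
  obtain ⟨q, hq⟩ := exists_polynomial_near_of_continuousOn (-1) 1 (fun x => √(p.eval x))
    (by fun_prop) η hη0
  refine ⟨q, fun x hx => ?_⟩
  have h1 := hq x hx
  have h2 : √(p.eval x) ^ 2 = p.eval x := Real.sq_sqrt (hp x hx)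
  have h3 : √(p.eval x) ≤ √K := Real.sqrt_le_sqrt ((le_abs_self _).trans (hpK x hx).le)
  have h0 : 0 ≤ √(p.eval x) := Real.sqrt_nonneg _
  rw [eval_sub, eval_pow, ← h2]
  generalize √(p.eval x) = s at *
  have h4 : |q.eval x - s| < 1 := h1.trans_le (min_le_left _ _)
  have h5 : |q.eval x + s| ≤ 2 * √K + 1 := by
    rw [abs_lt] at h4
    rw [abs_le]
    constructor <;> linarith
  calc |s ^ 2 - q.eval x ^ 2| = |q.eval x - s| * |q.eval x + s| := by
        rw [← abs_mul, abs_sub_comm]; ring_nf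
    _ ≤ |q.eval x - s| * (2 * √K + 1) := by gcongr
    _ < η * (2 * √K + 1) := by gcongr
    _ ≤ δ / (2 * √K + 1) * (2 * √K + 1) := by gcongr; exact min_le_right _ _
    _ = δ := by field_simp

theorem algebraMap_add_aeval_mul_aeval_mem_cycCone_of_nonneg {n : ℕ} (i j : Fin n) {p h : ℝ[X]}
    (hp : ∀ x ∈ Set.Icc (-1 : ℝ) 1, 0 ≤ p.eval x) (hh : h ∈ intervalCone) {ε : ℝ} (hε : 0 < ε) :
    algebraMap ℝ _ ε + aeval (FreeAlgebra.ι ℝ i) p * aeval (FreeAlgebra.ι ℝ j) h ∈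
      cycCone n := by
  obtain ⟨K, hK, hhK⟩ := exists_abs_eval_lt h
  obtain ⟨q, hq⟩ := exists_sq_near hp (div_pos hε hK)
  have h1 := algebraMap_add_aeval_mul_aeval_mem_cycCone i j (div_pos hε hK) hK hq hhK
  rw [div_mul_cancel₀ _ hK.ne'] at h1
  convert add_mem h1 (aeval_sq_mul_aeval_mem_cycCone i j q hh) using 1
  rw [add_assoc, ← add_mul, ← map_add, sub_add_cancel]

/-! ### Bernstein approximation of the powers of the second variable -/

/-- The Bernstein polynomials transported from `[0, 1]` to `[-1, 1]` lie in `intervalCone`, and the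
powers in a finite set are approximated by combinations of them whose coefficients are the values
at the nodes `t k`. -/
theorem exists_bernstein_near_pow (s : Finset ℕ) {δ : ℝ} (hδ : 0 < δ) :
    ∃ (n : ℕ) (b : Fin n → ℝ[X]) (t : Fin n → ℝ), (∀ k, b k ∈ intervalCone) ∧
      (∀ k, t k ∈ Set.Icc (-1 : ℝ) 1) ∧
      ∀ j ∈ s, ∀ y ∈ Set.Icc (-1 : ℝ) 1, |(X ^ j - ∑ k, C (t k ^ j) * b k).eval y| < δ := by
  let f : ℕ → C(unitInterval, ℝ) := fun j => ⟨fun u => (2 * (u : ℝ) - 1) ^ j, by fun_prop⟩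
  have hev : ∀ᶠ n in Filter.atTop, ∀ j ∈ s, ‖bernsteinApproximation n (f j) - f j‖ < δ := by
    rw [Filter.eventually_all_finset]
    intro j _
    have := (bernsteinApproximation_uniform (f j)).eventually (Metric.ball_mem_nhds _ hδ)
    simpa [dist_eq_norm] using this
  obtain ⟨n, hn⟩ := hev.exists
  let u : ℝ[X] := C (1 / 2) * (1 + X)
  refine ⟨n + 1, fun k => (bernsteinPolynomial ℝ n k).comp u,
    fun k => 2 * (bernstein.z k : ℝ) - 1, fun k => ?_, fun k => ?_, fun j hj y hy => ?_⟩
  · have h1 : (1 - u : ℝ[X]) = C (1 / 2) * (1 - X) := by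
      linear_combination (-1 : ℝ[X]) * C_half_add_half
    have h2 : C (1 / 2 : ℝ) ∈ intervalCone := C_mem_intervalCone (by norm_num)
    simp only [bernsteinPolynomial, mul_comp, natCast_comp, pow_comp, X_comp, sub_comp, one_comp,
      h1]
    exact mul_mem (mul_mem (natCast_mem _ _)
      (pow_mem (mul_mem h2 one_add_X_mem_intervalCone) _))
      (pow_mem (mul_mem h2 one_sub_X_mem_intervalCone) _)
  · have h0 := (bernstein.z k).2.1
    have h1 := (bernstein.z k).2.2
    constructor <;> linarith
  · let v : unitInterval := ⟨(1 / 2) * (1 + y), by constructor <;> linarith [hy.1, hy.2]⟩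
    have h1 := ((bernsteinApproximation n (f j) - f j).norm_coe_le_norm v).trans_lt (hn j hj)
    rw [Real.norm_eq_abs, ContinuousMap.sub_apply, abs_sub_comm] at h1
    refine lt_of_eq_of_lt (congrArg abs ?_) h1
    have hv : 2 * ((1 / 2) * (1 + y)) - 1 = y := by ring
    rw [bernsteinApproximation.apply, eval_sub, eval_finsetSum]
    congr 1
    · simp only [f, v, ContinuousMap.coe_mk, hv, eval_pow, eval_X]
    · refine Finset.sum_congr rfl fun k _ => ?_
      simp [f, v, u, bernstein_apply, bernsteinPolynomial]
      ring

/-! ### Sorted real polynomials -/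

/-- The linear section of the commutative collapse that writes every monomial as `X ^ i * Y ^ j`. -/
noncomputable def sortedLift (R : Type*) [CommRing R] :
    MvPolynomial (Fin 2) R →ₗ[R] FreeAlgebra R (Fin 2) :=
  (MvPolynomial.basisMonomials (Fin 2) R).constr R
    fun m => FreeAlgebra.ι R 0 ^ m 0 * FreeAlgebra.ι R 1 ^ m 1

theorem sortedLift_monomial {R : Type*} [CommRing R] (m : Fin 2 →₀ ℕ) (c : R) :
    sortedLift R (MvPolynomial.monomial m c) =
      c • (FreeAlgebra.ι R 0 ^ m 0 * FreeAlgebra.ι R 1 ^ m 1) := by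
  have h : sortedLift R (MvPolynomial.basisMonomials (Fin 2) R m) =
      FreeAlgebra.ι R 0 ^ m 0 * FreeAlgebra.ι R 1 ^ m 1 :=
    (MvPolynomial.basisMonomials (Fin 2) R).constr_basis R _ m
  simp only [MvPolynomial.coe_basisMonomials] at h
  rw [← mul_one c, ← smul_eq_mul, ← MvPolynomial.smul_monomial, map_smul, h, smul_eq_mul, mul_one]

theorem sortedLift_apply {R : Type*} [CommRing R] (Q : MvPolynomial (Fin 2) R) :
    sortedLift R Q =
      ∑ m ∈ Q.support, Q.coeff m • (FreeAlgebra.ι R 0 ^ m 0 * FreeAlgebra.ι R 1 ^ m 1) := by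
  conv_lhs => rw [Q.as_sum, map_sum]
  exact Finset.sum_congr rfl fun m _ => sortedLift_monomial m _

theorem algebraMap_add_sum_mem_cycCone {n : ℕ} {ι : Type*} (s : Finset ι)
    {a : ι → FreeAlgebra ℝ (Fin n)}
    (ha : ∀ i ∈ s, ∀ ε : ℝ, 0 < ε → algebraMap ℝ _ ε + a i ∈ cycCone n) {ε : ℝ} (hε : 0 < ε) :
    algebraMap ℝ _ ε + ∑ i ∈ s, a i ∈ cycCone n := by
  classical
  induction s using Finset.induction_on generalizing ε with
  | empty => simpa using algebraMap_mem_cycCone hε.le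
  | insert i s hi ih =>
    rw [Finset.sum_insert hi]
    have h1 := add_mem (ha i (Finset.mem_insert_self i s) (ε / 2) (half_pos hε))
      (ih (fun j hj => ha j (Finset.mem_insert_of_mem hj)) (half_pos hε))
    rwa [add_add_add_comm, ← map_add, add_halves] at h1

/-- Replacing `Y ^ j` by its Bernstein approximation turns a sorted polynomial into
`∑ k, Q(X, t k) * b k (Y)`, with nonnegative `Q(·, t k)`; the error terms are products of a bounded
polynomial in `X` and a small polynomial in `Y`. -/
theorem algebraMap_add_sortedLift_mem_cycCone {Q : MvPolynomial (Fin 2) ℝ}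
    (hQ : ∀ x y : ℝ, x ∈ Set.Icc (-1 : ℝ) 1 → y ∈ Set.Icc (-1 : ℝ) 1 →
      0 ≤ MvPolynomial.eval ![x, y] Q) {ε : ℝ} (hε : 0 < ε) :
    algebraMap ℝ _ ε + sortedLift ℝ Q ∈ cycCone 2 := by
  classical
  set K : ℝ := 1 + ∑ m ∈ Q.support, |Q.coeff m| with hK
  have hK0 : 0 < K := by positivity
  set N : ℝ := Q.support.card + 1 with hN
  have hN0 : 0 < N := by positivity
  obtain ⟨n, b, t, hb, ht, happ⟩ := exists_bernstein_near_pow (Q.support.image fun m => m 1)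
    (δ := ε / 2 / N / K) (by positivity)
  have hmain : algebraMap ℝ _ (ε / 2) +
      ∑ k, aeval (FreeAlgebra.ι ℝ 0) (∑ m ∈ Q.support, C (t k ^ m 1 * Q.coeff m) * X ^ m 0) *
        aeval (FreeAlgebra.ι ℝ 1) (b k) ∈ cycCone 2 := by
    refine algebraMap_add_sum_mem_cycCone _ (fun k _ η hη => ?_) (half_pos hε)
    refine algebraMap_add_aeval_mul_aeval_mem_cycCone_of_nonneg 0 1 (fun x hx => ?_) (hb k) hη
    have h := hQ x (t k) hx (ht k)
    rw [MvPolynomial.eval_eq'] at h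
    convert h using 1
    rw [eval_finsetSum]
    refine Finset.sum_congr rfl fun m _ => ?_
    simp [Fin.prod_univ_two]
    ring
  have herr : ∑ m ∈ Q.support, (algebraMap ℝ _ (K * (ε / 2 / N / K)) +
      aeval (FreeAlgebra.ι ℝ 0) (C (Q.coeff m) * X ^ m 0) *
        aeval (FreeAlgebra.ι ℝ 1) (X ^ m 1 - ∑ k, C (t k ^ m 1) * b k)) ∈ cycCone 2 := by
    refine sum_mem fun m hm => ?_
    refine algebraMap_add_aeval_mul_aeval_mem_cycCone 0 1 hK0 (by positivity) (fun x hx => ?_)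
      (happ _ (Finset.mem_image_of_mem _ hm))
    have h1 : |Q.coeff m| ≤ ∑ m ∈ Q.support, |Q.coeff m| :=
      Finset.single_le_sum (f := fun m => |Q.coeff m|) (fun _ _ => abs_nonneg _) hm
    have h2 : |x| ^ m 0 ≤ 1 := pow_le_one₀ (abs_nonneg x) (abs_le.mpr hx)
    rw [eval_mul, eval_C, eval_pow, eval_X, abs_mul, abs_pow]
    calc |Q.coeff m| * |x| ^ m 0 ≤ |Q.coeff m| * 1 := by gcongr
      _ < K := by linarith
  have hrest : algebraMap ℝ (FreeAlgebra ℝ (Fin 2)) (ε / 2 / N) ∈ cycCone 2 :=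
    algebraMap_mem_cycCone (by positivity)
  have hcancel : K * (ε / 2 / N / K) = ε / 2 / N := by field_simp
  convert add_mem (add_mem hmain herr) hrest using 1
  have hεN : ε = ε / 2 + Q.support.card • (ε / 2 / N) + ε / 2 / N := by
    rw [nsmul_eq_mul, hN]
    field_simp
    ring
  have hsum : sortedLift ℝ Q =
      ∑ k, aeval (FreeAlgebra.ι ℝ 0) (∑ m ∈ Q.support, C (t k ^ m 1 * Q.coeff m) * X ^ m 0) *
        aeval (FreeAlgebra.ι ℝ 1) (b k) +
      ∑ m ∈ Q.support, aeval (FreeAlgebra.ι ℝ 0) (C (Q.coeff m) * X ^ m 0) *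
        aeval (FreeAlgebra.ι ℝ 1) (X ^ m 1 - ∑ k, C (t k ^ m 1) * b k) := by
    simp only [map_sum, Finset.sum_mul]
    rw [Finset.sum_comm, ← Finset.sum_add_distrib, sortedLift_apply]
    refine Finset.sum_congr rfl fun m _ => ?_
    simp only [C_mul', map_smul, map_sub, aeval_X_pow, map_sum, mul_sub, Finset.mul_sum,
      smul_mul_assoc, mul_smul_comm, smul_smul]
    abel
  rw [Finset.sum_add_distrib, Finset.sum_const, hcancel, hsum]
  nth_rewrite 1 [hεN]
  rw [map_add, map_add, map_nsmul]
  abel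

/-! ### Descent from complex to real coefficients -/

theorem sortedLift_map (Q : MvPolynomial (Fin 2) ℝ) :
    sortedLift ℂ (MvPolynomial.map (algebraMap ℝ ℂ) Q) = realToComplex 2 (sortedLift ℝ Q) := by
  induction Q using MvPolynomial.induction_on' with
  | monomial m c =>
    rw [MvPolynomial.map_monomial, sortedLift_monomial, sortedLift_monomial, map_smul,
      algebraMap_smul, map_mul, map_pow, map_pow, realToComplex, FreeAlgebra.lift_ι_apply,
      FreeAlgebra.lift_ι_apply]
    rfl
  | add p q hp hq => simp only [map_add, hp, hq]

/-- Letting the variables commute and sorting again does not change the cyclic equivalence class of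
a cyclically sorted polynomial. -/
theorem IsCycSorted.cycEquiv_sortedLift {f : FreeAlgebra ℂ (Fin 2)} (hf : IsCycSorted f) :
    CycEquiv f (sortedLift ℂ (commImage f)) := by
  induction hf using Submodule.span_induction with
  | mem p hp =>
    obtain ⟨w, ⟨i, j, hw⟩, rfl⟩ := hp
    refine hw.trans (.of_eq ?_)
    have h := (hw.map (commImage : FreeAlgebra ℂ (Fin 2) →+* MvPolynomial (Fin 2) ℂ)).eq
    have h' : commImage (word w) = MvPolynomial.monomial
        (Finsupp.single 0 i + Finsupp.single 1 j) 1 := by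
      refine h.trans ?_
      simp [commImage, MvPolynomial.X_pow_eq_monomial, MvPolynomial.monomial_mul]
    rw [h', sortedLift_monomial]
    simp
  | zero => simpa using CycEquiv.refl 0
  | add p q _ _ hp hq => simpa only [map_add] using hp.add hq
  | smul c p _ hp => simpa only [map_smul] using hp.smul c

/-- A complex polynomial that is real-valued on the square has real coefficients: it agrees there
with its coefficientwise conjugate. -/
theorem NonnegOnSquare.exists_map_eq {p : MvPolynomial (Fin 2) ℂ} (hp : NonnegOnSquare p) :
    ∃ Q : MvPolynomial (Fin 2) ℝ, MvPolynomial.map (algebraMap ℝ ℂ) Q = p := by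
  have hconj : MvPolynomial.map (starRingEnd ℂ) p = p := by
    have hinf : (((↑) : ℝ → ℂ) '' Set.Icc (-1 : ℝ) 1).Infinite :=
      (Set.Icc_infinite (by norm_num)).image Complex.ofReal_injective.injOn
    refine MvPolynomial.funext_set (fun _ => _) (fun _ => hinf) fun z hz => ?_
    choose x hx hxz using fun i => hz i (Set.mem_univ i)
    obtain rfl : (fun i => (x i : ℂ)) = z := funext hxz
    obtain ⟨r, -, hr⟩ := hp x hx
    have h1 : (starRingEnd ℂ) (MvPolynomial.eval (fun i => (x i : ℂ)) p) =
        MvPolynomial.eval (fun i => (x i : ℂ)) (MvPolynomial.map (starRingEnd ℂ) p) := by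
      rw [MvPolynomial.eval_map, ← MvPolynomial.coe_eval₂Hom, MvPolynomial.map_eval]
      simp [Function.comp_def, MvPolynomial.eval_map]
    rw [← h1, hr, Complex.conj_ofReal]
  refine ⟨∑ m ∈ p.support, MvPolynomial.monomial m (p.coeff m).re, ?_⟩
  conv_rhs => rw [p.as_sum]
  rw [map_sum]
  refine Finset.sum_congr rfl fun m _ => ?_
  have h2 := congrArg (MvPolynomial.coeff m) hconj
  rw [MvPolynomial.coeff_map] at h2
  rw [MvPolynomial.map_monomial]
  exact congrArg _ (Complex.conj_eq_iff_re.mp h2)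

end CycSorted

theorem proposition4p2 (f : FreeAlgebra ℂ (Fin 2)) (hf : CycSorted.IsCycSorted f)
    (hpos : CycSorted.NonnegOnSquare (CycSorted.commImage f)) :
    ∀ ε : ℝ, 0 < ε →
      ∃ g ∈ CycSorted.realQuadraticModule 2,
        CycSorted.CycEquiv (f + algebraMap ℂ (FreeAlgebra ℂ (Fin 2)) (ε : ℂ))
          (CycSorted.realToComplex 2 g) := by
  intro ε hε
  obtain ⟨Q, hQ⟩ := hpos.exists_map_eq
  have hQpos : ∀ x y : ℝ, x ∈ Set.Icc (-1 : ℝ) 1 → y ∈ Set.Icc (-1 : ℝ) 1 →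
      0 ≤ MvPolynomial.eval ![x, y] Q := by
    intro x y hx hy
    obtain ⟨r, hr0, hr⟩ := hpos ![x, y] (by simp [Fin.forall_fin_two, hx.1, hx.2, hy.1, hy.2])
    rw [← hQ, MvPolynomial.eval_map] at hr
    have h : MvPolynomial.eval₂ (algebraMap ℝ ℂ) (fun i => ((![x, y] i : ℝ) : ℂ)) Q =
        ((MvPolynomial.eval ![x, y] Q : ℝ) : ℂ) :=
      (MvPolynomial.eval₂_comp (algebraMap ℝ ℂ) ![x, y] Q).symm
    rw [h] at hr
    rwa [Complex.ofReal_injective hr]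
  obtain ⟨g, hg, hQg⟩ := CycSorted.algebraMap_add_sortedLift_mem_cycCone hQpos hε
  refine ⟨g, hg, ?_⟩
  have h1 := hQg.map (CycSorted.realToComplex 2 : FreeAlgebra ℝ (Fin 2) →+* FreeAlgebra ℂ (Fin 2))
  refine (hf.cycEquiv_sortedLift.add (.refl _)).trans (.trans (.of_eq ?_) h1)
  rw [← hQ, CycSorted.sortedLift_map, add_comm]
  simp [IsScalarTower.algebraMap_apply ℝ ℂ (FreeAlgebra ℂ (Fin 2))]
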